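/- For an integer $n\ge 4$ let $T_n^*$ be the tree with vertex set $\{v_0,v_1,\dots,v_{n-1}\}$ and edge set $\{v_0v_1,\dots,v_0v_{n-3},\,v_{n-3}v_{n-2},\,v_{n-2}v_{n-1}\}$, and let $\mathrm{ex}(p;T_n^*)$ denote the maximal number of edges in a simple graph with $p$ vertices that does not contain $T_n^*$ as a (not necessarily induced) subgraph. Let $p,n$ be positive integers with $p\ge n-1\ge 5$, and write $p=k(n-1)+r$ with integers $k\ge 1$ and $0\le r\le n-2$. Then $$\mathrm{ex}(p;T_n^*)=\begin{cases}\dfrac{(k-1)(n-1)(n-2)}{2}+\mathrm{ex}(n-1+r;T_n^*) & \text{if } 1\le r\le n-5,\\[2mm] \dfrac{(n-2)p-r(n-1-r)}{2} & \text{if } r\in\{0,\,n-4,\,n-3,\,n-2\}.\end{cases}$$ Moreover, for every integer $m\ge 2n-5$, $$\mathrm{ex}(m;T_n^*)=\binom{n-1}{2}+\mathrm{ex}(m-(n-1);T_n^*).$$ -/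

import Mathlib

/-- The tree `T_n^*` (for `n ≥ 4`) on the vertices `v_0, …, v_{n-1}`, with edges
`v_0 v_1, …, v_0 v_{n-3}`, `v_{n-3} v_{n-2}` and `v_{n-2} v_{n-1}`. -/
def treeStar (n : ℕ) : SimpleGraph (Fin n) :=
  SimpleGraph.fromRel fun i j : Fin n =>
    (i.val = 0 ∧ 1 ≤ j.val ∧ j.val + 3 ≤ n) ∨
    (i.val + 3 = n ∧ j.val + 2 = n) ∨
    (i.val + 2 = n ∧ j.val + 1 = n)

/-- `ex(p; T_n^*)`: the maximal number of edges of a simple graph of order `p` that does not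
contain a copy of `T_n^*` as a (not necessarily induced) subgraph. -/
noncomputable def exTreeStar (p n : ℕ) : ℕ :=
  SimpleGraph.extremalNumber p (treeStar n)

open Finset SimpleGraph

section
open scoped Classical

variable {V W : Type*}

/-! Everything rests on the recursion `exTreeStar_eq_choose_add`: for m ≥ 2n-5, a component K_{n-1}
can be split off without loss. A disjoint K_{n-1} gives the lower bound. For the upper bound,
consider a T_n^*-free graph on m vertices and its maximum degree.

If some v has degree at least n-2, freeness closes the ball of radius two around v into a component,
with at most as many edges as K_{n-1} together with an extremal graph on the remaining ball vertices
(`adjCount_univ_le_of_large_degree`).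

If all degrees are at most n-3, the degree sum is at most m(n-3). This suffices as soon as twice the
extremal number for j = m-(n-1) is at least (n-3)j-(n-1), which cliques and joins achieve for j ≥
n-3 (`mul_le_exTreeStar`). The remaining case m = 2n-5 needs its own count
(`adjCount_univ_le_of_card_eq`).

Iterating, the order drops to r when r ≥ n-4 and to n-1 when r = 0, where a complete graph is
extremal; for other r it stops at n-1+r. -/

/-! ### Copies of the tree as a path with extra neighbours -/

/-- A copy of `T_n^*` is a path `v a b c` together with `n - 4` further neighbours of `v`. -/
theorem treeStar_isContained_iff {n : ℕ} (hn : 4 ≤ n) (G : SimpleGraph V) :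
    treeStar n ⊑ G ↔ ∃ v a b c : V, ∃ S : Finset V, #S = n - 4 ∧ (∀ x ∈ S, G.Adj v x) ∧
      G.Adj v a ∧ G.Adj a b ∧ G.Adj b c ∧ v ≠ b ∧ v ≠ c ∧ a ≠ c ∧ a ∉ S ∧ b ∉ S ∧ c ∉ S := by
  constructor
  · rintro ⟨f⟩
    have hadj : ∀ i j : Fin n, (treeStar n).Adj i j → G.Adj (f i) (f j) :=
      fun i j h => f.toHom.map_adj h
    have hinj : ∀ i j : Fin n, f i = f j → i.val = j.val :=
      fun i j h => congrArg Fin.val (f.injective h)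
    refine ⟨f ⟨0, by omega⟩, f ⟨n - 3, by omega⟩, f ⟨n - 2, by omega⟩, f ⟨n - 1, by omega⟩,
      univ.image fun i : Fin (n - 4) => f ⟨i.val + 1, by omega⟩, ?_, ?_, ?_, ?_, ?_, ?_, ?_, ?_,
      ?_, ?_, ?_⟩
    · rw [card_image_of_injective, card_univ, Fintype.card_fin]
      intro i j h
      have := hinj _ _ h
      ext
      simpa using this
    · simp only [mem_image, mem_univ, true_and, forall_exists_index, forall_apply_eq_imp_iff]
      intro i
      have hi := i.isLt
      apply hadj
      simp only [treeStar, fromRel_adj, ne_eq, Fin.mk.injEq, true_and]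
      omega
    any_goals
      apply hadj
      simp only [treeStar, fromRel_adj, ne_eq, Fin.mk.injEq, true_and]
      omega
    iterate 3
      · intro h
        have := hinj _ _ h
        simp only at this
        omega
    all_goals
      simp only [mem_image, mem_univ, true_and, not_exists]
      intro i h
      have hi := i.isLt
      have := hinj _ _ h
      simp only at this
      omega
  · rintro ⟨v, a, b, c, S, hS, hvS, hva, hab, hbc, hvb, hvc, hac, haS, hbS, hcS⟩
    let e : Fin (n - 4) ≃ S := (Finset.equivFinOfCardEq hS).symm
    let f : Fin n → V := fun i => if i.val = 0 then v else
      if h : i.val - 1 < n - 4 then e ⟨i.val - 1, h⟩ else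
      if i.val + 3 = n then a else if i.val + 2 = n then b else c
    have hvS' : v ∉ S := fun h => (hvS v h).ne rfl
    have h0 : ∀ i : Fin n, i.val = 0 → f i = v := fun i hi => by simp [f, hi]
    have hs : ∀ i : Fin n, i.val ≠ 0 → ∀ h : i.val - 1 < n - 4, f i = e ⟨i.val - 1, h⟩ :=
      fun i hi h => by simp [f, hi, h]
    have ha : ∀ i : Fin n, i.val + 3 = n → f i = a := fun i hi => by
      have h1 : ¬ i.val = 0 := by omega
      have h2 : ¬ i.val - 1 < n - 4 := by omega
      simp only [f, if_neg h1, dif_neg h2, if_pos hi]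
    have hb : ∀ i : Fin n, i.val + 2 = n → f i = b := fun i hi => by
      have h1 : ¬ i.val = 0 := by omega
      have h2 : ¬ i.val - 1 < n - 4 := by omega
      have h3 : ¬ i.val + 3 = n := by omega
      simp only [f, if_neg h1, dif_neg h2, if_neg h3, if_pos hi]
    have hc : ∀ i : Fin n, i.val + 1 = n → f i = c := fun i hi => by
      have h1 : ¬ i.val = 0 := by omega
      have h2 : ¬ i.val - 1 < n - 4 := by omega
      have h3 : ¬ i.val + 3 = n := by omega
      have h4 : ¬ i.val + 2 = n := by omega
      simp only [f, if_neg h1, dif_neg h2, if_neg h3, if_neg h4]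
    have hcase : ∀ i : Fin n, i.val = 0 ∨ (i.val ≠ 0 ∧ i.val - 1 < n - 4) ∨ i.val + 3 = n ∨
        i.val + 2 = n ∨ i.val + 1 = n := fun i => by omega
    have hrel : ∀ i j : Fin n, ((i.val = 0 ∧ 1 ≤ j.val ∧ j.val + 3 ≤ n) ∨
        (i.val + 3 = n ∧ j.val + 2 = n) ∨ (i.val + 2 = n ∧ j.val + 1 = n)) →
        G.Adj (f i) (f j) := by
      rintro i j (⟨hi, hj1, hj2⟩ | ⟨hi, hj⟩ | ⟨hi, hj⟩)
      · rw [h0 i hi]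
        by_cases h : j.val + 3 = n
        · rwa [ha j h]
        · rw [hs j (by omega) (by omega)]
          exact hvS _ (Subtype.property _)
      · rwa [ha i hi, hb j hj]
      · rwa [hb i hi, hc j hj]
    refine ⟨⟨⟨f, ?_⟩, ?_⟩⟩
    · intro i j h
      simp only [treeStar, fromRel_adj] at h
      rcases h.2 with h | h
      · exact hrel i j h
      · exact (hrel j i h).symm
    · intro i j hij
      change f i = f j at hij
      have hmem : ∀ k : Fin n, k.val ≠ 0 → k.val - 1 < n - 4 → f k ∈ S := fun k hk hk' => by
        rw [hs k hk hk']
        exact Subtype.property _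
      by_cases h : (i.val ≠ 0 ∧ i.val - 1 < n - 4) ∧ (j.val ≠ 0 ∧ j.val - 1 < n - 4)
      · rw [hs i h.1.1 h.1.2, hs j h.2.1 h.2.2] at hij
        have := congrArg Fin.val (e.injective (Subtype.ext hij))
        simp only at this
        omega
      · have hva' := hva.ne
        have hab' := hab.ne
        have hbc' := hbc.ne
        apply Fin.ext
        have hi := hcase i
        have hj := hcase j
        clear_value f
        grind

/-! ### Degree sums between vertex sets -/

/-- The neighbours of `x` in `B`. -/
noncomputable def nbrsIn (G : SimpleGraph V) (B : Finset V) (x : V) : Finset V :=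
  {y ∈ B | G.Adj x y}

theorem mem_nbrsIn {G : SimpleGraph V} {B : Finset V} {x y : V} :
    y ∈ nbrsIn G B x ↔ y ∈ B ∧ G.Adj x y :=
  mem_filter

theorem card_nbrsIn (G : SimpleGraph V) (B : Finset V) (x : V) :
    #(nbrsIn G B x) = ∑ y ∈ B, if G.Adj x y then 1 else 0 :=
  card_filter _ _

/-- The number of ordered pairs of adjacent vertices, the first in `A` and the second in `B`. -/
noncomputable def adjCount (G : SimpleGraph V) (A B : Finset V) : ℕ :=
  ∑ x ∈ A, #(nbrsIn G B x)

theorem adjCount_comm (G : SimpleGraph V) (A B : Finset V) :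
    adjCount G A B = adjCount G B A := by
  simp only [adjCount, card_nbrsIn]
  rw [sum_comm]
  simp only [G.adj_comm]

theorem adjCount_union_left (G : SimpleGraph V) {A A' : Finset V} (h : Disjoint A A')
    (B : Finset V) : adjCount G (A ∪ A') B = adjCount G A B + adjCount G A' B :=
  sum_union h

theorem adjCount_union_right (G : SimpleGraph V) (A : Finset V) {B B' : Finset V}
    (h : Disjoint B B') : adjCount G A (B ∪ B') = adjCount G A B + adjCount G A B' := by
  rw [adjCount_comm, adjCount_union_left G h, adjCount_comm G B, adjCount_comm G B']

theorem adjCount_union_self (G : SimpleGraph V) {A B : Finset V} (h : Disjoint A B) :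
    adjCount G (A ∪ B) (A ∪ B) = adjCount G A A + 2 * adjCount G A B + adjCount G B B := by
  rw [adjCount_union_left G h, adjCount_union_right G _ h, adjCount_union_right G _ h,
    adjCount_comm G B A]
  ring

theorem adjCount_eq_zero (G : SimpleGraph V) {A B : Finset V}
    (h : ∀ x ∈ A, ∀ y ∈ B, ¬ G.Adj x y) : adjCount G A B = 0 := by
  refine sum_eq_zero fun x hx => ?_
  rw [card_eq_zero, eq_empty_iff_forall_notMem]
  exact fun y hy => h x hx y (mem_nbrsIn.1 hy).1 (mem_nbrsIn.1 hy).2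

theorem adjCount_le_mul (G : SimpleGraph V) {A B : Finset V} {d : ℕ}
    (h : ∀ x ∈ A, #(nbrsIn G B x) ≤ d) : adjCount G A B ≤ #A * d := by
  simpa [adjCount] using sum_le_card_nsmul A _ d h

theorem adjCount_self_le (G : SimpleGraph V) (A : Finset V) :
    adjCount G A A ≤ #A * (#A - 1) := by
  refine adjCount_le_mul G fun x hx => ?_
  rw [← card_erase_of_mem hx]
  refine card_le_card fun y hy => ?_
  rw [mem_nbrsIn] at hy
  exact mem_erase.2 ⟨hy.2.ne', hy.1⟩

theorem adjCount_univ [Fintype V] (G : SimpleGraph V) [Fintype G.edgeSet] :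
    adjCount G univ univ = 2 * #G.edgeFinset := by
  have h := sum_degrees_eq_twice_card_edges G
  trans ∑ v, G.degree v
  swap
  · rw [h]
    congr!
  refine sum_congr rfl fun x _ => ?_
  rw [← card_neighborFinset_eq_degree, neighborFinset_eq_filter, nbrsIn]

theorem adjCount_univ_sup_edge [Fintype V] {G : SimpleGraph V} {x y : V} (h : ¬ G.Adj x y)
    (hxy : x ≠ y) : adjCount (G ⊔ edge x y) univ univ = adjCount G univ univ + 2 := by
  have := card_edgeFinset_sup_edge G h hxy
  rw [adjCount_univ, adjCount_univ, this]
  ring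

/-! ### Extremal numbers, complete graphs and disjoint unions -/

theorem adjCount_le_of_free [Fintype V] {H : SimpleGraph W} {G : SimpleGraph V}
    (h : H.Free G) (S : Finset V) : adjCount G S S ≤ 2 * extremalNumber #S H := by
  have hfree : H.Free (G.induce (S : Set V)) := fun hc => h (hc.trans ⟨Copy.induce G _⟩)
  have h1 := card_edgeFinset_le_extremalNumber hfree
  have h2 := adjCount_univ (G.induce (S : Set V))
  have h3 : Fintype.card (S : Set V) = #S := by simp
  rw [h3] at h1
  have h4 : adjCount (G.induce (S : Set V)) univ univ = adjCount G S S := by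
    unfold adjCount
    simp only [card_nbrsIn]
    rw [← sum_coe_sort S]
    refine sum_congr rfl fun x _ => ?_
    rw [← sum_coe_sort S]
    rfl
  omega

theorem exists_free_adjCount_eq {H : SimpleGraph W} (hH : H ≠ ⊥) (j : ℕ) :
    ∃ G : SimpleGraph (Fin j), H.Free G ∧ adjCount G univ univ = 2 * extremalNumber j H := by
  obtain ⟨G, _, hG⟩ := exists_isExtremal_free (V := Fin j) hH
  refine ⟨G, hG.prop, ?_⟩
  have h := card_edgeFinset_of_isExtremal_free hG
  rw [Fintype.card_fin] at h
  rw [adjCount_univ, ← h]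

theorem treeStar_ne_bot {n : ℕ} (hn : 4 ≤ n) : treeStar n ≠ ⊥ := by
  intro h
  have : (treeStar n).Adj ⟨0, by omega⟩ ⟨1, by omega⟩ := by
    simp only [treeStar, fromRel_adj, ne_eq, Fin.mk.injEq, true_and]
    omega
  rw [h] at this
  exact this

theorem two_mul_exTreeStar_le {j n : ℕ} (hn : 4 ≤ n) {B : ℕ}
    (h : ∀ G : SimpleGraph (Fin j), (treeStar n).Free G → adjCount G univ univ ≤ B) :
    2 * exTreeStar j n ≤ B := by
  obtain ⟨G, hG, hE⟩ := exists_free_adjCount_eq (treeStar_ne_bot hn) j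
  rw [exTreeStar, ← hE]
  exact h G hG

theorem adjCount_univ_le_exTreeStar [Fintype V] {n : ℕ} {G : SimpleGraph V}
    (h : (treeStar n).Free G) : adjCount G univ univ ≤ 2 * exTreeStar (Fintype.card V) n :=
  adjCount_le_of_free h univ

theorem exTreeStar_of_lt {j n : ℕ} (hn : 4 ≤ n) (hj : j < n) :
    2 * exTreeStar j n = j * (j - 1) := by
  apply le_antisymm
  · refine two_mul_exTreeStar_le hn fun G _ => ?_
    simpa using adjCount_self_le G univ
  · have hfree : (treeStar n).Free (⊤ : SimpleGraph (Fin j)) := by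
      rintro ⟨f⟩
      have := Fintype.card_le_of_injective f f.injective
      simp only [Fintype.card_fin] at this
      omega
    have h := adjCount_univ_le_exTreeStar hfree
    rw [adjCount_univ] at h
    rw [card_edgeFinset_top_eq_card_choose_two, Fintype.card_fin, Nat.choose_two_right] at h
    have := Nat.even_mul_pred_self j
    have := Nat.two_mul_div_two_of_even this
    omega

/-- The tree is connected, so a copy of it stays inside one summand. -/
theorem treeStar_free_sum {n : ℕ} (hn : 4 ≤ n) {G : SimpleGraph V} {H : SimpleGraph W}
    (hG : (treeStar n).Free G) (hH : (treeStar n).Free H) : (treeStar n).Free (G ⊕g H) := by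
  intro h
  rw [treeStar_isContained_iff hn] at h
  obtain ⟨v, a, b, c, S, hS, hvS, hva, hab, hbc, hvb, hvc, hac, haS, hbS, hcS⟩ := h
  rcases v with v | v
  · rcases a with a | a
    swap
    · exact (Bool.false_ne_true hva).elim
    rcases b with b | b
    swap
    · exact (Bool.false_ne_true hab).elim
    rcases c with c | c
    swap
    · exact (Bool.false_ne_true hbc).elim
    refine hG ((treeStar_isContained_iff hn G).2 ⟨v, a, b, c,
      S.preimage Sum.inl Sum.inl_injective.injOn, ?_, ?_, hva, hab, hbc, ?_, ?_, ?_, ?_, ?_, ?_⟩)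
    · rw [← hS, card_preimage, filter_true_of_mem]
      rintro (x | x) hx
      · exact ⟨x, rfl⟩
      · exact (Bool.false_ne_true (hvS _ hx)).elim
    · exact fun x hx => hvS _ (mem_preimage.1 hx)
    all_goals simp_all
  · rcases a with a | a
    · exact (Bool.false_ne_true hva).elim
    rcases b with b | b
    · exact (Bool.false_ne_true hab).elim
    rcases c with c | c
    · exact (Bool.false_ne_true hbc).elim
    refine hH ((treeStar_isContained_iff hn H).2 ⟨v, a, b, c,
      S.preimage Sum.inr Sum.inr_injective.injOn, ?_, ?_, hva, hab, hbc, ?_, ?_, ?_, ?_, ?_, ?_⟩)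
    · rw [← hS, card_preimage, filter_true_of_mem]
      rintro (x | x) hx
      · exact (Bool.false_ne_true (hvS _ hx)).elim
      · exact ⟨x, rfl⟩
    · exact fun x hx => hvS _ (mem_preimage.1 hx)
    all_goals simp_all

theorem exTreeStar_add_le {n : ℕ} (hn : 4 ≤ n) (i j : ℕ) :
    exTreeStar i n + exTreeStar j n ≤ exTreeStar (i + j) n := by
  obtain ⟨G, hG, hGE⟩ := exists_free_adjCount_eq (treeStar_ne_bot hn) i
  obtain ⟨H, hH, hHE⟩ := exists_free_adjCount_eq (treeStar_ne_bot hn) j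
  have h := adjCount_univ_le_exTreeStar (treeStar_free_sum hn hG hH)
  have hE : adjCount (G ⊕g H) univ univ = adjCount G univ univ + adjCount H univ univ := by
    unfold adjCount
    simp only [card_nbrsIn, Fintype.sum_sum_type]
    simp
  rw [hE, hGE, hHE, Fintype.card_sum, Fintype.card_fin, Fintype.card_fin] at h
  simp only [exTreeStar] at *
  omega

/-! ### Nearly regular graphs -/

/-- Among the graphs with all degrees at most `D`, one with the maximal number of edges has total
degree deficiency at most one: otherwise an edge can be added, or an edge `a b` can be replaced by
two edges `x a` and `y b`. -/
theorem exists_nearly_regular [Fintype V] {D : ℕ} (hD : D < Fintype.card V) :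
    ∃ K : SimpleGraph V, (∀ x, #(nbrsIn K univ x) ≤ D) ∧
      Fintype.card V * D ≤ adjCount K univ univ + 1 := by
  obtain ⟨K, hK, hmax⟩ := exists_max_image
    ({K | ∀ x, #(nbrsIn K univ x) ≤ D} : Finset (SimpleGraph V)) (fun K => adjCount K univ univ)
    ⟨⊥, by rw [mem_filter_univ]; simp [nbrsIn]⟩
  have hdeg : ∀ x, #(nbrsIn K univ x) ≤ D := by simpa using hK
  replace hmax : ∀ K' : SimpleGraph V, (∀ x, #(nbrsIn K' univ x) ≤ D) →
      adjCount K' univ univ ≤ adjCount K univ univ := fun K' h => hmax K' (by simpa using h)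
  refine ⟨K, hdeg, ?_⟩
  by_contra! hlt
  have hadd : ∀ x y, x ≠ y → ¬ K.Adj x y → #(nbrsIn K univ x) < D → #(nbrsIn K univ y) = D := by
    intro x y hxy hadj hx
    by_contra hy
    have hy : #(nbrsIn K univ y) < D := lt_of_le_of_ne (hdeg y) hy
    have h1 := hmax (K ⊔ edge x y) ?_
    · rw [adjCount_univ_sup_edge hadj hxy] at h1
      omega
    · intro u
      rcases eq_or_ne u x with rfl | hux
      · have : nbrsIn (K ⊔ edge u y) univ u ⊆ insert y (nbrsIn K univ u) := by
          intro z
          simp only [mem_nbrsIn, mem_univ, true_and, mem_insert, sup_adj, edge_adj]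
          grind
        have := card_le_card this
        have := card_insert_le y (nbrsIn K univ u)
        omega
      · rcases eq_or_ne u y with rfl | huy
        · have : nbrsIn (K ⊔ edge x u) univ u ⊆ insert x (nbrsIn K univ u) := by
            intro z
            simp only [mem_nbrsIn, mem_univ, true_and, mem_insert, sup_adj, edge_adj]
            grind
          have := card_le_card this
          have := card_insert_le x (nbrsIn K univ u)
          omega
        · refine le_trans (card_le_card ?_) (hdeg u)
          intro z
          simp only [mem_nbrsIn, mem_univ, true_and, sup_adj, edge_adj]
          grind
  -- Replacing `a b` by `x a` and `y b` preserves the degrees of `a` and `b`; only `x` and `y` gain,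
  -- by two in total if they coincide.
  have hswitch : ∀ x y a b, K.Adj a b → ¬ K.Adj x a → ¬ K.Adj y b → x ≠ a → y ≠ b → y ≠ a →
      (if x = y then #(nbrsIn K univ x) + 2 ≤ D else
        #(nbrsIn K univ x) + 1 ≤ D ∧ #(nbrsIn K univ y) + 1 ≤ D) → False := by
    intro x y a b hab hxa hyb hxa' hyb' hya' hd
    have hxb : x ≠ b := fun h => hxa (h ▸ hab.symm)
    have hne := hab.ne
    set K₀ := K.deleteEdges {s(a, b)} with hK₀
    have hK₀adj : ∀ u w, K₀.Adj u w ↔ K.Adj u w ∧ ¬ (u = a ∧ w = b) ∧ ¬ (u = b ∧ w = a) := by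
      intro u w
      simp only [hK₀, deleteEdges_adj, Set.mem_singleton_iff, Sym2.eq_iff, not_or]
    have hK : K₀ ⊔ edge a b = K := by
      ext u w
      rw [sup_adj, edge_adj, hK₀adj]
      have := hab.symm
      grind
    have c0 : adjCount (K₀ ⊔ edge a b) univ univ = adjCount K₀ univ univ + 2 :=
      adjCount_univ_sup_edge (by rw [hK₀adj]; simp) hne
    rw [hK] at c0
    have c1 : adjCount (K₀ ⊔ edge x a) univ univ = adjCount K₀ univ univ + 2 :=
      adjCount_univ_sup_edge (by rw [hK₀adj]; tauto) hxa'
    have c2 : adjCount (K₀ ⊔ edge x a ⊔ edge y b) univ univ =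
        adjCount (K₀ ⊔ edge x a) univ univ + 2 := by
      refine adjCount_univ_sup_edge ?_ hyb'
      rw [sup_adj, hK₀adj, edge_adj]
      grind
    have hadj' : ∀ u w, (K₀ ⊔ edge x a ⊔ edge y b).Adj u w ↔
        (K.Adj u w ∧ ¬ (u = a ∧ w = b) ∧ ¬ (u = b ∧ w = a)) ∨ (x = u ∧ a = w) ∨
        (x = w ∧ a = u) ∨ (y = u ∧ b = w) ∨ (y = w ∧ b = u) := by
      intro u w
      rw [sup_adj, sup_adj, hK₀adj, edge_adj, edge_adj]
      grind
    have h1 := hmax (K₀ ⊔ edge x a ⊔ edge y b) ?_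
    · omega
    intro u
    by_cases hua : u = a
    · subst u
      have hmem : b ∈ (nbrsIn K univ a) := mem_nbrsIn.2 ⟨mem_univ _, hab⟩
      have : nbrsIn (K₀ ⊔ edge x a ⊔ edge y b) univ a ⊆
          insert x ((nbrsIn K univ a).erase b) := by
        intro z
        simp only [mem_nbrsIn, mem_univ, true_and, mem_insert, mem_erase, hadj']
        grind
      have := card_le_card this
      have := card_insert_le x ((nbrsIn K univ a).erase b)
      have := card_erase_add_one hmem
      have := hdeg a
      omega
    by_cases hub : u = b
    · subst u
      have hmem : a ∈ (nbrsIn K univ b) := mem_nbrsIn.2 ⟨mem_univ _, hab.symm⟩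
      have : nbrsIn (K₀ ⊔ edge x a ⊔ edge y b) univ b ⊆
          insert y ((nbrsIn K univ b).erase a) := by
        intro z
        simp only [mem_nbrsIn, mem_univ, true_and, mem_insert, mem_erase, hadj']
        grind
      have := card_le_card this
      have := card_insert_le y ((nbrsIn K univ b).erase a)
      have := card_erase_add_one hmem
      have := hdeg b
      omega
    have hsub : nbrsIn (K₀ ⊔ edge x a ⊔ edge y b) univ u ⊆
        (if x = u then {a} else ∅) ∪ ((if y = u then {b} else ∅) ∪
          (nbrsIn K univ u)) := by
      intro z
      simp only [mem_nbrsIn, mem_univ, true_and, mem_union, hadj']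
      grind
    refine (card_le_card hsub).trans ((card_union_le _ _).trans
      ((Nat.add_le_add_left (card_union_le _ _) _).trans ?_))
    have := hdeg u
    grind
  have hsum : adjCount K univ univ = ∑ x, #(nbrsIn K univ x) := rfl
  have hpair : ∃ x y, (if x = y then #(nbrsIn K univ x) + 2 ≤ D else
        #(nbrsIn K univ x) + 1 ≤ D ∧ #(nbrsIn K univ y) + 1 ≤ D) := by
    by_contra! hno
    have h2 : ∀ x, D ≤ #(nbrsIn K univ x) + 1 := fun x => by
      have := hno x x
      simp only [if_true] at this
      omega
    have hx : ∃ x, #(nbrsIn K univ x) < D := by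
      by_contra! h
      have := card_nsmul_le_sum univ _ D fun x _ => h x
      rw [card_univ, smul_eq_mul, ← hsum] at this
      omega
    obtain ⟨x, hx⟩ := hx
    have hy : ∀ y ∈ univ.erase x, D ≤ #(nbrsIn K univ y) := by
      intro y hy
      have := hno x y
      rw [if_neg (ne_of_mem_erase hy).symm] at this
      by_contra! hlt
      exact this ⟨hx, hlt⟩
    have h3 := card_nsmul_le_sum _ _ D hy
    rw [card_erase_of_mem (mem_univ x), card_univ, smul_eq_mul] at h3
    have h4 := add_sum_erase univ (fun x => #(nbrsIn K univ x)) (mem_univ x)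
    have h5 : Fintype.card V * D = (Fintype.card V - 1) * D + D := by
      rw [← Nat.succ_mul]
      congr 1
      omega
    have := h2 x
    omega
  obtain ⟨x, y, hxy⟩ := hpair
  have hx : #(nbrsIn K univ x) < D := by split_ifs at hxy <;> omega
  have hy : #(nbrsIn K univ y) < D := by
    split_ifs at hxy with h
    · subst h; omega
    · omega
  have hxy' : x = y ∨ K.Adj x y := by
    by_contra! h
    have := hadd x y h.1 h.2 hx
    omega
  obtain ⟨a, ha⟩ : ∃ a, a ∉ insert x (nbrsIn K univ x) := by
    by_contra! h
    have h1 := card_le_card (fun z _ => h z : univ ⊆ insert x (nbrsIn K univ x))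
    have := card_insert_le x (nbrsIn K univ x)
    rw [card_univ] at h1
    omega
  simp only [mem_insert, mem_nbrsIn, mem_univ, true_and, not_or] at ha
  have hda := hadd x a (Ne.symm ha.1) ha.2 hx
  -- `a` has degree `D`, while the excluded set has at most deg `y` < `D` elements: `x` is erased
  -- from it, harmlessly since `a` is not adjacent to `x`.
  obtain ⟨b, hb, hb'⟩ : ∃ b ∈ (nbrsIn K univ a),
      b ∉ (insert y (nbrsIn K univ y)).erase x := by
    by_contra! h
    have h1 := card_le_card (fun z hz => h z hz)
    have h2 : x ∈ insert y (nbrsIn K univ y) := by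
      simp only [mem_insert, mem_nbrsIn, mem_univ, true_and]
      exact hxy'.imp id fun h => h.symm
    have := card_erase_add_one h2
    have := card_insert_le y (nbrsIn K univ y)
    omega
  simp only [mem_insert, mem_nbrsIn, mem_univ, true_and, mem_erase, not_and, not_or] at hb hb'
  have hbx : b ≠ x := fun h => ha.2 (h ▸ hb.symm)
  refine hswitch x y a b hb ha.2 (hb' hbx).2 (Ne.symm ha.1) (Ne.symm (hb' hbx).1) ?_ hxy
  rintro rfl
  exact hxy'.elim (fun h => ha.1 h.symm) ha.2

/-! ### Lower bounds by construction -/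

theorem exTreeStar_add_clique_le {n : ℕ} (hn : 4 ≤ n) (j : ℕ) :
    (n - 1) * (n - 2) + 2 * exTreeStar j n ≤ 2 * exTreeStar (n - 1 + j) n := by
  have h1 := exTreeStar_of_lt hn (by omega : n - 1 < n)
  have h2 := exTreeStar_add_le hn (n - 1) j
  rw [show n - 1 - 1 = n - 2 by omega] at h1
  omega

/-- A crude bound to absorb the surplus vertices of a ball of radius two. The constant 4 comes from
j(j-1) - 3j + 4 = (j-2)². -/
theorem three_mul_le_exTreeStar {n : ℕ} (hn : 6 ≤ n) (j : ℕ) :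
    3 * j ≤ 2 * exTreeStar j n + 4 := by
  induction j using Nat.strong_induction_on with
  | _ j ih =>
    rcases lt_or_ge j n with hj | hj
    · rw [exTreeStar_of_lt (by omega) hj]
      rcases j with _ | j
      · omega
      · rw [Nat.add_sub_cancel]
        zify
        nlinarith [sq_nonneg ((j : ℤ) - 1)]
    · obtain ⟨i, rfl⟩ := Nat.exists_eq_add_of_le (by omega : n - 1 ≤ j)
      have h1 := ih i (by omega)
      have h2 := exTreeStar_add_clique_le (by omega : 4 ≤ n) i
      have h3 : (n - 1) * 3 ≤ (n - 1) * (n - 2) := Nat.mul_le_mul_left _ (by omega)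
      omega

/-- The join of an edgeless graph on `V` with a graph `K` on `W`. -/
def emptyJoin (V : Type*) {W : Type*} (K : SimpleGraph W) : SimpleGraph (V ⊕ W) :=
  (⊥ ⊕g K) ⊔ completeBipartiteGraph V W

/-- The centre v of a copy needs degree n-3. If v lies on the edgeless side, its chosen neighbours
exhaust `W`, which leaves the adjacent vertices b and c on the edgeless side. If v lies in `W`, its
degree is too small, or the graph is K_{n-3,n-3} and the same argument applies. -/
theorem treeStar_free_emptyJoin [Fintype V] [Fintype W] {n : ℕ} (hn : 4 ≤ n) {K : SimpleGraph W}
    (hW : Fintype.card W = n - 3)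
    (hK : (∀ i, Fintype.card V + #(nbrsIn K univ i) < n - 3) ∨
      (Fintype.card V = n - 3 ∧ K = ⊥)) : (treeStar n).Free (emptyJoin V K) := by
  intro h
  rw [treeStar_isContained_iff hn] at h
  obtain ⟨v, a, b, c, S, hS, hvS, hva, hab, hbc, hvb, hvc, hac, haS, hbS, hcS⟩ := h
  have hcard : #(insert a S) = n - 3 := by
    rw [card_insert_of_notMem haS, hS]
    omega
  have hbS' : b ∉ insert a S := by simp [hbS, hab.ne']
  have hcS' : c ∉ insert a S := by simp [hcS, hac.symm]
  have hN : ∀ x ∈ insert a S, (emptyJoin V K).Adj v x := by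
    intro x hx
    rcases mem_insert.1 hx with rfl | hx
    · exact hva
    · exact hvS x hx
  generalize insert a S = U at *
  rcases v with v | v
  · have hU : U = univ.image Sum.inr := by
      refine eq_of_subset_of_card_le ?_ ?_
      · intro x hx
        have := hN x hx
        rcases x with x | x
        · simp [emptyJoin] at this
        · simp
      · rw [card_image_of_injective _ Sum.inr_injective, card_univ, hW, hcard]
    rw [hU] at hbS' hcS'
    rcases b with b | b
    · rcases c with c | c
      · simp [emptyJoin] at hbc
      · simp at hcS'
    · simp at hbS'
  · rcases hK with hK | ⟨hV, rfl⟩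
    · have hU : U ⊆ univ.image Sum.inl ∪ (nbrsIn K univ v).image Sum.inr := by
        intro x hx
        have := hN x hx
        rcases x with x | x
        · simp
        · simpa [emptyJoin, mem_nbrsIn] using this
      have h1 := (card_le_card hU).trans (card_union_le _ _)
      rw [card_image_of_injective _ Sum.inl_injective, card_image_of_injective _ Sum.inr_injective,
        card_univ] at h1
      have := hK v
      omega
    · have hU : U = univ.image Sum.inl := by
        refine eq_of_subset_of_card_le ?_ ?_
        · intro x hx
          have := hN x hx
          rcases x with x | x
          · simp
          · simp [emptyJoin] at this
        · rw [card_image_of_injective _ Sum.inl_injective, card_univ, hV, hcard]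
      rw [hU] at hbS' hcS'
      rcases b with b | b
      · simp at hbS'
      · rcases c with c | c
        · simp at hcS'
        · simp [emptyJoin] at hbc

theorem adjCount_emptyJoin [Fintype V] [Fintype W] (K : SimpleGraph W) :
    adjCount (emptyJoin V K) univ univ =
      2 * (Fintype.card V * Fintype.card W) + adjCount K univ univ := by
  unfold adjCount
  simp only [card_nbrsIn, Fintype.sum_sum_type]
  simp [emptyJoin, sum_add_distrib]
  ring

theorem mul_le_exTreeStar_of_lt {n R : ℕ} (hn : 6 ≤ n) (hR : R + 5 ≤ n) :
    (n - 3) * (n - 1 + R) ≤ 2 * exTreeStar (n - 1 + R) n + (n - 1) := by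
  obtain ⟨K, hK, hE⟩ : ∃ K : SimpleGraph (Fin (n - 3)),
      ((∀ i, Fintype.card (Fin (R + 2)) + #(nbrsIn K univ i) < n - 3) ∨
        (Fintype.card (Fin (R + 2)) = n - 3 ∧ K = ⊥)) ∧
      (n - 3) * (n - 5 - R) ≤ adjCount K univ univ + (n - 1) := by
    rcases Nat.lt_or_ge (R + 5) n with h | h
    -- With degrees at most n-6-R inside `K`, a vertex of `K` has degree at most n-4 in the join.
    · obtain ⟨K, hK, hE⟩ := exists_nearly_regular (V := Fin (n - 3)) (D := n - 6 - R)
        (by rw [Fintype.card_fin]; omega)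
      refine ⟨K, Or.inl fun i => ?_, ?_⟩
      · have := hK i
        rw [Fintype.card_fin]
        omega
      · rw [Fintype.card_fin] at hE
        rw [show n - 5 - R = n - 6 - R + 1 by omega, mul_add]
        omega
    · refine ⟨⊥, Or.inr ⟨by rw [Fintype.card_fin]; omega, rfl⟩, ?_⟩
      rw [show n - 5 - R = 0 by omega, mul_zero]
      exact Nat.zero_le _
  have h := adjCount_univ_le_exTreeStar
    (treeStar_free_emptyJoin (by omega : 4 ≤ n) (Fintype.card_fin _) hK)
  rw [adjCount_emptyJoin, Fintype.card_sum, Fintype.card_fin, Fintype.card_fin,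
    show R + 2 + (n - 3) = n - 1 + R by omega] at h
  have e : (n - 3) * (n - 1 + R) = (n - 3) * (n - 5 - R) + 2 * ((R + 2) * (n - 3)) := by
    rw [show n - 1 + R = n - 5 - R + 2 * (R + 2) by omega]
    ring
  omega

/-- The loss n-1 is exactly what the comparison of m(n-3) with a split-off K_{n-1} allows. -/
theorem mul_le_exTreeStar {n j : ℕ} (hn : 6 ≤ n) (hj : n - 3 ≤ j) :
    (n - 3) * j ≤ 2 * exTreeStar j n + (n - 1) := by
  induction j using Nat.strong_induction_on with
  | _ j ih =>
    obtain ⟨N, rfl⟩ := Nat.exists_eq_add_of_le' hn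
    have hclique := exTreeStar_add_clique_le (by omega : 4 ≤ N + 6)
    have hsmall : ∀ i, i < N + 6 → 2 * exTreeStar i (N + 6) = i * (i - 1) :=
      fun i hi => exTreeStar_of_lt (by omega) hi
    simp only [show N + 6 - 1 = N + 5 by omega,
      show N + 6 - 2 = N + 4 by omega, show N + 6 - 3 = N + 3 by omega] at *
    rcases Nat.lt_or_ge j (N + 5) with h | h
    · have h1 := hsmall j (by omega)
      obtain rfl | rfl : j = N + 3 ∨ j = N + 4 := by omega
      · rw [h1, show N + 3 - 1 = N + 2 by omega]
        nlinarith
      · rw [h1, show N + 4 - 1 = N + 3 by omega]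
        nlinarith
    · obtain ⟨R, rfl⟩ := Nat.exists_eq_add_of_le h
      have h1 := hclique R
      rcases Nat.lt_or_ge R (N + 2) with hR | hR
      · exact mul_le_exTreeStar_of_lt hn (by omega)
      -- For j = 2n-5 the disjoint union of K_{n-1} and K_{n-4} suffices; beyond that a K_{n-1} is
      -- added inductively.
      rcases Nat.lt_or_ge R (N + 3) with hR' | hR'
      · obtain rfl : R = N + 2 := by omega
        have h2 := hsmall (N + 2) (by omega)
        rw [show N + 2 - 1 = N + 1 by omega] at h2
        nlinarith
      · have h2 := ih R (by omega) hR'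
        nlinarith

/-! ### Upper bound in the presence of a large degree -/

theorem card_nbrsIn_sdiff_lt_of_free [Fintype V] {n : ℕ} (hn : 4 ≤ n) {G : SimpleGraph V}
    (hG : (treeStar n).Free G) {v a b c : V} (hva : G.Adj v a) (hab : G.Adj a b)
    (hbc : G.Adj b c) (hvb : v ≠ b) (hvc : v ≠ c) (hac : a ≠ c) :
    #(nbrsIn G univ v \ {a, b, c}) < n - 4 := by
  by_contra! h
  obtain ⟨S, hS, hcard⟩ := exists_subset_card_eq h
  refine hG ((treeStar_isContained_iff hn G).2 ⟨v, a, b, c, S, hcard, fun x hx => ?_, hva, hab,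
    hbc, hvb, hvc, hac, fun h => ?_, fun h => ?_, fun h => ?_⟩)
  · exact (mem_nbrsIn.1 (mem_sdiff.1 (hS hx)).1).2
  all_goals
    have := (mem_sdiff.1 (hS h)).2
    simp at this

/-- The vertices at distance two from `v`. -/
noncomputable def secondNbrs [Fintype V] (G : SimpleGraph V) (v : V) : Finset V :=
  {w | w ≠ v ∧ ¬ G.Adj v w ∧ ∃ x, G.Adj v x ∧ G.Adj x w}

theorem mem_secondNbrs [Fintype V] {G : SimpleGraph V} {v w : V} :
    w ∈ secondNbrs G v ↔ w ≠ v ∧ ¬ G.Adj v w ∧ ∃ x, G.Adj v x ∧ G.Adj x w := by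
  simp [secondNbrs]

/-- The vertices at distance at most two from `v`. -/
noncomputable def ballTwo [Fintype V] (G : SimpleGraph V) (v : V) : Finset V :=
  ({v} ∪ secondNbrs G v) ∪ nbrsIn G univ v

theorem disjoint_singleton_secondNbrs [Fintype V] (G : SimpleGraph V) (v : V) :
    Disjoint {v} (secondNbrs G v) := by
  simp [mem_secondNbrs]

theorem disjoint_ballTwo [Fintype V] (G : SimpleGraph V) (v : V) :
    Disjoint ({v} ∪ secondNbrs G v) (nbrsIn G univ v) := by
  rw [Finset.disjoint_left]
  intro x hx hx'
  have hvx := (mem_nbrsIn.1 hx').2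
  rcases mem_union.1 hx with h | h
  · rw [mem_singleton.1 h] at hvx
    exact hvx.ne rfl
  · exact (mem_secondNbrs.1 h).2.1 hvx

theorem card_ballTwo [Fintype V] (G : SimpleGraph V) (v : V) :
    #(ballTwo G v) = 1 + #(secondNbrs G v) + #(nbrsIn G univ v) := by
  rw [ballTwo, card_union_of_disjoint (disjoint_ballTwo G v),
    card_union_of_disjoint (disjoint_singleton_secondNbrs G v), card_singleton]

/-- If the neighbours of all vertices at distance two from `v` are neighbours of `v`, then the ball
of radius two is a union of components. -/
theorem adjCount_univ_eq_ballTwo_add [Fintype V] {G : SimpleGraph V} {v : V}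
    (h : ∀ w ∈ secondNbrs G v, ∀ z, G.Adj w z → G.Adj v z) :
    adjCount G univ univ =
      adjCount G (ballTwo G v) (ballTwo G v) + adjCount G (ballTwo G v)ᶜ (ballTwo G v)ᶜ := by
  have h0 : adjCount G (ballTwo G v) (ballTwo G v)ᶜ = 0 := by
    refine adjCount_eq_zero G fun x hx y hy hxy => ?_
    simp only [mem_compl, ballTwo, mem_union, mem_singleton, mem_nbrsIn, mem_univ, true_and,
      not_or, mem_secondNbrs] at hx hy
    rcases hx with (rfl | hx) | hx
    · exact hy.2 hxy
    · exact hy.2 (h x (mem_secondNbrs.2 hx) y hxy)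
    · exact hy.1.2 ⟨hy.1.1, hy.2, x, hx, hxy⟩
  have := adjCount_union_self G (disjoint_compl_right (a := ballTwo G v))
  rw [← sup_eq_union, sup_compl_eq_top] at this
  rw [h0] at this
  simpa using this

/-- Under the hypothesis, `v` and the vertices at distance two form an independent set. -/
theorem adjCount_ballTwo [Fintype V] {G : SimpleGraph V} {v : V}
    (h : ∀ w ∈ secondNbrs G v, ∀ z, G.Adj w z → G.Adj v z) :
    adjCount G (ballTwo G v) (ballTwo G v) =
      2 * #(nbrsIn G univ v) + 2 * adjCount G (secondNbrs G v) (nbrsIn G univ v) +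
        adjCount G (nbrsIn G univ v) (nbrsIn G univ v) := by
  have h0 : adjCount G ({v} ∪ secondNbrs G v) ({v} ∪ secondNbrs G v) = 0 := by
    refine adjCount_eq_zero G fun x hx y hy hxy => ?_
    simp only [mem_union, mem_singleton] at hx hy
    have hvy : G.Adj v y := by
      rcases hx with rfl | hx
      · exact hxy
      · exact h x hx y hxy
    rcases hy with rfl | hy
    · exact hvy.ne rfl
    · exact (mem_secondNbrs.1 hy).2.1 hvy
  have h1 : adjCount G {v} (nbrsIn G univ v) = #(nbrsIn G univ v) := by
    rw [adjCount, sum_singleton]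
    congr 1
    ext y
    simp [mem_nbrsIn]
  rw [ballTwo, adjCount_union_self G (disjoint_ballTwo G v), h0,
    adjCount_union_left G (disjoint_singleton_secondNbrs G v), h1]
  ring

theorem adjCount_univ_le_of_large_degree [Fintype V] {n : ℕ} (hn : 6 ≤ n) {G : SimpleGraph V}
    (hG : (treeStar n).Free G) {v : V} (hv : n - 2 ≤ #(nbrsIn G univ v)) :
    adjCount G univ univ ≤
      (n - 1) * (n - 2) + 2 * exTreeStar (Fintype.card V - (n - 1)) n := by
  set N := nbrsIn G univ v with hN
  have hmemN : ∀ {x}, x ∈ N ↔ G.Adj v x := by simp [hN, mem_nbrsIn]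
  have hlt : ∀ {a b c}, G.Adj v a → G.Adj a b → G.Adj b c → v ≠ b → v ≠ c → a ≠ c →
      #(N \ {a, b, c}) < n - 4 := fun h1 h2 h3 h4 h5 h6 =>
    card_nbrsIn_sdiff_lt_of_free (by omega) hG h1 h2 h3 h4 h5 h6
  have htwo : ∀ a b : V, n - 4 ≤ #(N \ {a, b}) := fun a b => by
    have h1 := le_card_sdiff ({a, b} : Finset V) N
    have h2 := card_le_two (a := a) (b := b)
    omega
  -- A vertex `w` at distance two has a single neighbour: a second one would extend `v x w` to a
  -- path, and since `w` is not in `N`, at least n-4 further neighbours of `v` remain.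
  have hleaf : ∀ w ∈ secondNbrs G v, ∀ x, G.Adj v x → G.Adj x w → ∀ z, G.Adj w z → z = x := by
    intro w hw x hvx hxw z hwz
    by_contra hzx
    obtain ⟨hwv, hvw, -⟩ := mem_secondNbrs.1 hw
    have hvz : v ≠ z := by
      rintro rfl
      exact hvw hwz.symm
    have h1 := hlt hvx hxw hwz (Ne.symm hwv) hvz (Ne.symm hzx)
    have h2 : N \ {x, w, z} = N \ {x, z} := by
      ext y
      simp only [mem_sdiff, mem_insert, mem_singleton, hmemN]
      grind
    have := htwo x z
    rw [h2] at h1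
    omega
  have hnbr : ∀ w ∈ secondNbrs G v, ∀ z, G.Adj w z → G.Adj v z := by
    intro w hw z hwz
    obtain ⟨-, -, x, hvx, hxw⟩ := mem_secondNbrs.1 hw
    rwa [hleaf w hw x hvx hxw z hwz]
  have hsecond : adjCount G (secondNbrs G v) N ≤ #(secondNbrs G v) := by
    rw [← mul_one #(secondNbrs G v)]
    refine adjCount_le_mul G fun w hw => card_le_one.2 fun y hy z hz => ?_
    obtain ⟨-, -, x, hvx, hxw⟩ := mem_secondNbrs.1 hw
    rw [hleaf w hw x hvx hxw z (mem_nbrsIn.1 hz).2, hleaf w hw x hvx hxw y (mem_nbrsIn.1 hy).2]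
  have hsplit := adjCount_univ_eq_ballTwo_add hnbr
  rw [adjCount_ballTwo hnbr] at hsplit
  have hrest := adjCount_le_of_free hG (ballTwo G v)ᶜ
  change _ ≤ 2 * exTreeStar _ n at hrest
  have hball := card_ballTwo G v
  have hcompl := card_compl (ballTwo G v)
  have hballle := card_le_univ (ballTwo G v)
  -- The ball vertices beyond n-1 are regrouped with the rest of the graph.
  have hmove := exTreeStar_add_le (by omega : 4 ≤ n) (#(ballTwo G v) - (n - 1)) #(ballTwo G v)ᶜ
  rw [← hN] at hsplit hball
  rw [show #(ballTwo G v) - (n - 1) + #(ballTwo G v)ᶜ = Fintype.card V - (n - 1) by omega]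
    at hmove
  have hthree := three_mul_le_exTreeStar hn (#(ballTwo G v) - (n - 1))
  rcases Nat.lt_or_ge (n - 2) #N with hd | hd
  -- With n-1 or more neighbours, `N` induces a matching: two neighbours y, z in `N` of some x in
  -- `N` give the path v y x z, and n-4 neighbours are left over.
  · have hNN : adjCount G N N ≤ #N * 1 := by
      refine adjCount_le_mul G fun x hx => card_le_one.2 fun y hy z hz => ?_
      by_contra hyz
      obtain ⟨hyN, hxy⟩ := mem_nbrsIn.1 hy
      obtain ⟨hzN, hxz⟩ := mem_nbrsIn.1 hz
      have h1 := hlt (hmemN.1 hyN) hxy.symm hxz (hmemN.1 hx).ne (hmemN.1 hzN).ne hyz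
      have h2 := le_card_sdiff ({y, x, z} : Finset V) N
      have h3 := card_le_three (a := y) (b := x) (c := z)
      omega
    have h4 : (n - 1) * 4 ≤ (n - 1) * (n - 2) := Nat.mul_le_mul_left _ (by omega)
    omega
  · have hd : #N = n - 2 := by omega
    rcases (secondNbrs G v).eq_empty_or_nonempty with h0 | ⟨w, hw⟩
    · have hNN := adjCount_self_le G N
      have hcard0 := card_eq_zero.2 h0
      have h5 : 2 * (n - 2) + (n - 2) * (n - 2 - 1) = (n - 1) * (n - 2) := by
        rw [show n - 1 = n - 2 - 1 + 2 by omega]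
        ring
      rw [hd] at hNN
      omega
    · obtain ⟨hwv, hvw, x, hvx, hxw⟩ := mem_secondNbrs.1 hw
      -- A neighbour `x` of `v` that leads to distance two is isolated within `N`, which costs more
      -- than the pendant edges bring.
      have hx0 : adjCount G {x} N = 0 := by
        refine adjCount_eq_zero G fun x' hx' y hy hxy => ?_
        rw [mem_singleton.1 hx'] at hxy
        have h1 := hlt (hmemN.1 hy) hxy.symm hxw hvx.ne (Ne.symm hwv)
          (fun h => hvw (h ▸ hmemN.1 hy))
        have h2 : N \ {y, x, w} = N \ {y, x} := by
          ext y
          simp only [mem_sdiff, mem_insert, mem_singleton, hmemN]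
          grind
        have := htwo y x
        rw [h2] at h1
        omega
      have hxN : x ∈ N := hmemN.2 hvx
      have hdisj : Disjoint {x} (N.erase x) := by simp
      have hNx : {x} ∪ N.erase x = N := by
        rw [← insert_eq, insert_erase hxN]
      have h1 := adjCount_union_self G hdisj
      have h3 := adjCount_union_right G {x} hdisj
      rw [hNx] at h1 h3
      have h4 := adjCount_self_le G (N.erase x)
      rw [card_erase_of_mem hxN, hd] at h4
      have hpos : 0 < #(secondNbrs G v) := card_pos.2 ⟨w, hw⟩
      have h5 : (n - 2 - 1) * (n - 2 - 1 - 1) + 4 * n = (n - 1) * (n - 2) + 10 := by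
        obtain ⟨k, rfl⟩ := Nat.exists_eq_add_of_le' hn
        rw [show k + 6 - 2 - 1 = k + 3 by omega, show k + 3 - 1 = k + 2 by omega,
          show k + 6 - 1 = k + 5 by omega, show k + 6 - 2 = k + 4 by omega]
        ring
      omega

/-! ### Upper bound for small degrees on 2n-5 vertices -/

theorem adjCount_univ_le_of_card_eq [Fintype V] {n : ℕ} (hn : 6 ≤ n) {G : SimpleGraph V}
    (hG : (treeStar n).Free G) (hcard : Fintype.card V = 2 * n - 5)
    (hdeg : ∀ x, #(nbrsIn G univ x) ≤ n - 3) :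
    adjCount G univ univ ≤ (n - 1) * (n - 2) + (n - 4) * (n - 5) := by
  by_cases hlow : ∀ x, #(nbrsIn G univ x) ≤ n - 4
  · have h1 := adjCount_le_mul G (A := univ) (B := univ) fun x _ => hlow x
    rw [card_univ, hcard] at h1
    refine h1.trans ?_
    obtain ⟨k, rfl⟩ := Nat.exists_eq_add_of_le' hn
    rw [show 2 * (k + 6) - 5 = 2 * k + 7 by omega, show k + 6 - 4 = k + 2 by omega,
      show k + 6 - 1 = k + 5 by omega, show k + 6 - 2 = k + 4 by omega,
      show k + 6 - 5 = k + 1 by omega]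
    nlinarith
  push Not at hlow
  obtain ⟨v, hv⟩ := hlow
  have hv : #(nbrsIn G univ v) = n - 3 := le_antisymm (hdeg v) (by omega)
  set N := nbrsIn G univ v with hN
  have hmemN : ∀ {x}, x ∈ N ↔ G.Adj v x := by simp [hN, mem_nbrsIn]
  -- With deg v = n-3, an edge from `w` to some z outside `N` completes a copy of the tree using all
  -- of `N`.
  have hnbr : ∀ w ∈ secondNbrs G v, ∀ z, G.Adj w z → G.Adj v z := by
    intro w hw z hwz
    by_contra hvz
    obtain ⟨hwv, hvw, x, hvx, hxw⟩ := mem_secondNbrs.1 hw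
    have h1 := card_nbrsIn_sdiff_lt_of_free (by omega) hG hvx hxw hwz (Ne.symm hwv)
      (fun h => hvw (h ▸ hwz.symm)) (fun h => hvz (h ▸ hvx))
    have h2 : N \ {x, w, z} = N.erase x := by
      ext y
      simp only [mem_sdiff, mem_insert, mem_singleton, hmemN, mem_erase]
      grind
    rw [← hN, h2, card_erase_of_mem (hmemN.2 hvx)] at h1
    omega
  have hsplit := adjCount_univ_eq_ballTwo_add hnbr
  have hball := card_ballTwo G v
  rw [← hN] at hball
  have hcompl := card_add_card_compl (ballTwo G v)
  have hdegN : adjCount G N univ ≤ (n - 3) * (n - 3) := by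
    rw [← hv]
    exact adjCount_le_mul G fun x _ => hv ▸ hdeg x
  have hmono : ∀ A B : Finset V, adjCount G A B ≤ adjCount G A univ := fun A B =>
    sum_le_sum fun x _ => card_le_card fun y hy =>
      mem_nbrsIn.2 ⟨mem_univ y, (mem_nbrsIn.1 hy).2⟩
  have hrest := adjCount_self_le G (ballTwo G v)ᶜ
  obtain ⟨k, rfl⟩ := Nat.exists_eq_add_of_le' hn
  simp only [show k + 6 - 1 = k + 5 by omega, show k + 6 - 2 = k + 4 by omega,
    show k + 6 - 3 = k + 3 by omega, show k + 6 - 4 = k + 2 by omega,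
    show k + 6 - 5 = k + 1 by omega] at *
  rcases Nat.eq_zero_or_pos #(ballTwo G v)ᶜ with h0 | hpos
  -- If the ball is everything, each edge meets `N`, so there are at most (n-3)² edges.
  · rw [h0, zero_mul] at hrest
    rw [adjCount_ballTwo hnbr, ← hN] at hsplit
    have h1 := adjCount_union_left G (disjoint_ballTwo G v) N
    rw [adjCount_union_left G (disjoint_singleton_secondNbrs G v)] at h1
    have h2 : adjCount G {v} N = #N := by
      rw [adjCount, sum_singleton]
      congr 1
      ext y
      simp [hmemN, mem_nbrsIn]
    have h3 := adjCount_comm G (ballTwo G v) N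
    rw [ballTwo, ← hN, h1, h2] at h3
    have h4 := hmono N ({v} ∪ secondNbrs G v ∪ N)
    nlinarith
  · have h1 : adjCount G (ballTwo G v) (ballTwo G v) ≤ #(ballTwo G v) * (k + 3) :=
      (hmono _ _).trans (adjCount_le_mul G fun x _ => hdeg x)
    obtain ⟨s, hs⟩ := Nat.exists_eq_add_of_le' (Nat.one_le_iff_ne_zero.2 hpos.ne')
    rw [hs] at hrest hcompl
    have hsk : s ≤ k + 2 := by omega
    obtain ⟨t, ht⟩ := Nat.exists_eq_add_of_le hsk
    have hc : #(ballTwo G v) = k + 4 + t := by omega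
    rw [hc] at h1
    rw [Nat.add_sub_cancel] at hrest
    -- With `s + 1` vertices outside the ball and `s + t = k + 2`, the two sides of the final
    -- inequality differ by `s * t + 4`.
    obtain rfl : k = s + t - 2 := by omega
    zify at *
    nlinarith

end

/-! ### The recursion and the closed formulas -/

theorem exTreeStar_eq_choose_add {n m : ℕ} (hn : 6 ≤ n) (hm : 2 * n - 5 ≤ m) :
    exTreeStar m n = (n - 1).choose 2 + exTreeStar (m - (n - 1)) n := by
  have hchoose : 2 * (n - 1).choose 2 = (n - 1) * (n - 2) := by
    rw [Nat.choose_two_right, Nat.two_mul_div_two_of_even (Nat.even_mul_pred_self _)]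
    rfl
  have hlower := exTreeStar_add_clique_le (by omega : 4 ≤ n) (m - (n - 1))
  rw [show n - 1 + (m - (n - 1)) = m by omega] at hlower
  have hupper : 2 * exTreeStar m n ≤ (n - 1) * (n - 2) + 2 * exTreeStar (m - (n - 1)) n := by
    refine two_mul_exTreeStar_le (by omega) fun G hG => ?_
    by_cases hdeg : ∀ x, #(nbrsIn G univ x) ≤ n - 3
    · rcases Nat.eq_or_lt_of_le hm with rfl | hm'
      · refine (adjCount_univ_le_of_card_eq hn hG (Fintype.card_fin _) hdeg).trans ?_
        rw [exTreeStar_of_lt (by omega) (by omega), show 2 * n - 5 - (n - 1) = n - 4 by omega]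
        rfl
      · have h1 := adjCount_le_mul G (A := univ) (B := univ) fun x _ => hdeg x
        rw [card_univ, Fintype.card_fin] at h1
        have h2 := mul_le_exTreeStar hn (by omega : n - 3 ≤ m - (n - 1))
        have h3 : m * (n - 3) + (n - 1) =
            (n - 3) * (m - (n - 1)) + (n - 1) * (n - 2) := by
          obtain ⟨j, rfl⟩ := Nat.exists_eq_add_of_le (by omega : n - 1 ≤ m)
          rw [Nat.add_sub_cancel_left, show n - 2 = n - 3 + 1 by omega]
          ring
        omega
    · push Not at hdeg
      obtain ⟨v, hv⟩ := hdeg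
      have := adjCount_univ_le_of_large_degree hn hG (v := v) (by omega)
      rwa [Fintype.card_fin] at this
  omega

/-- The bound n-4 ≤ i is what the last application of the recursion needs: (n-1) + i ≥ 2n-5. -/
theorem exTreeStar_add_mul {n : ℕ} (hn : 6 ≤ n) {i : ℕ} (hi : n - 4 ≤ i) (k : ℕ) :
    exTreeStar (k * (n - 1) + i) n = k * (n - 1).choose 2 + exTreeStar i n := by
  induction k with
  | zero => simp
  | succ k ih =>
    have hle : i ≤ k * (n - 1) + i := Nat.le_add_left _ _
    rw [show (k + 1) * (n - 1) + i = k * (n - 1) + i + (n - 1) by ring,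
      exTreeStar_eq_choose_add hn (by omega), Nat.add_sub_cancel, ih]
    ring

theorem theorem4p1 (p n k r : ℕ) (hn : 5 ≤ n - 1) (hp : n - 1 ≤ p)
    (hpk : p = k * (n - 1) + r) (hr : r ≤ n - 2) :
    (1 ≤ r ∧ r ≤ n - 5 →
      (exTreeStar p n : ℚ) =
        ((k : ℚ) - 1) * ((n : ℚ) - 1) * ((n : ℚ) - 2) / 2 + (exTreeStar (n - 1 + r) n : ℚ)) ∧
    (r = 0 ∨ r = n - 4 ∨ r = n - 3 ∨ r = n - 2 →
      (exTreeStar p n : ℚ) =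
        (((n : ℚ) - 2) * (p : ℚ) - (r : ℚ) * ((n : ℚ) - 1 - (r : ℚ))) / 2) ∧
    (∀ m : ℕ, 2 * n - 5 ≤ m →
      exTreeStar m n = (n - 1).choose 2 + exTreeStar (m - (n - 1)) n) := by
  have hn6 : 6 ≤ n := by omega
  obtain ⟨l, rfl⟩ : ∃ l, k = l + 1 := by
    rcases k with _ | l
    · omega
    · exact ⟨l, rfl⟩
  have hcast : ((n - 1 : ℕ) : ℚ) = n - 1 := by
    rw [Nat.cast_sub (by omega), Nat.cast_one]
  have hchoose : (((n - 1).choose 2 : ℕ) : ℚ) = ((n : ℚ) - 1) * (n - 2) / 2 := by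
    rw [Nat.cast_choose_two, hcast]
    ring
  have hsmall : ∀ i, i < n → (exTreeStar i n : ℚ) = i * (i - 1) / 2 := by
    intro i hi
    have h := congrArg (Nat.cast : ℕ → ℚ) (exTreeStar_of_lt (by omega : 4 ≤ n) hi)
    rcases i with _ | i
    · simpa using h
    · push_cast [Nat.add_sub_cancel] at h ⊢
      linarith
  refine ⟨fun _ => ?_, fun h => ?_, fun m hm => exTreeStar_eq_choose_add hn6 hm⟩
  · rw [hpk, show (l + 1) * (n - 1) + r = l * (n - 1) + (n - 1 + r) by ring,
      exTreeStar_add_mul hn6 (by omega)]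
    push_cast
    rw [hchoose]
    ring
  · rcases h with rfl | h
    -- For r = 0 the recursion cannot go down to order 0 and stops at K_{n-1}.
    · rw [hpk, show (l + 1) * (n - 1) + 0 = l * (n - 1) + (n - 1) by ring,
        exTreeStar_add_mul hn6 (by omega)]
      push_cast
      rw [hchoose, hsmall (n - 1) (by omega), hcast]
      ring
    · rw [hpk, exTreeStar_add_mul hn6 (by omega)]
      push_cast
      rw [hchoose, hsmall r (by omega), hcast]
      ring
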